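/- Let $\mathfrak h_{\mathbb C}=L^2(\mathbb R_+;\mathbb C)$ with Lebesgue measure on $\mathbb R_+=[0,\infty)$, let $\Gamma=\bigoplus_{n\ge0}\mathfrak h_{\mathbb C}^{\odot n}$ be the symmetric Fock space, where $\mathfrak h_{\mathbb C}^{\odot n}$ is identified with the space of symmetric functions in $L^2(\mathbb R_+^n;\mathbb C)$, and let $\mathcal E(k)=\sum_{n\ge0}k^{\otimes n}/\sqrt{n!}$, $k\in\mathfrak h_{\mathbb C}$, be the exponential vectors. Inner products are linear in the second argument. Let $L^2(\mathbb R_+,\mathcal B(\Gamma))$ be the set of maps $t\mapsto X_t\in\mathcal B(\Gamma)$ such that $t\mapsto X_t\psi$ is measurable for every $\psi\in\Gamma$ and $\int_{\mathbb R_+}\|X_t\|^2\,dt<\infty$. *Hitsuda–Skorohod integral.* A pair $X=(X^1,X^2)\in L^2(\mathbb R_+,\mathcal B(\Gamma))^2$ belongs to $\mathrm{Dom}\,\delta$ if there is $M\in\mathcal B(\Gamma)$ such that for all $k_1,k_2\in\mathfrak h_{\mathbb C}$ $$\langle\mathcal E(k_1),M\mathcal E(k_2)\rangle=\int_{\mathbb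 R_+}\Big(i\big(k_2(t)-\overline{k_1(t)}\big)\langle\mathcal E(k_1),X^1_t\mathcal E(k_2)\rangle+\big(\overline{k_1(t)}+k_2(t)\big)\langle\mathcal E(k_1),X^2_t\mathcal E(k_2)\rangle\Big)dt ,$$ and then $\int X^1\,dP+\int X^2\,dQ:=\delta(X):=M$ (which is unique, as the exponential vectors are total). *Belavkin–Lindsay integrals.* Let $\tilde D:\Gamma\supseteq\mathrm{Dom}\,\tilde D\to\Gamma\otimes\mathfrak h_{\mathbb C}\cong L^2(\mathbb R_+;\Gamma)$ be the closure of the linear operator defined on the span of the exponential vectors by $(\tilde D\mathcal E(k))_t=k(t)\mathcal E(k)$, and let $\tilde\delta=\tilde D^*$. For $F:\mathbb R_+\to\mathcal B(\Gamma)$ the annihilation integral is the operator $$\int^{\rm BL}F_t\,dA_t\,\psi=\int_{\mathbb R_+}F_t(\tilde D\psi)_t\,dt$$ (Bochner integral), with domain all $\psi\in\mathrm{Dom}\,\tilde D$ for which the integrand is Bochner integrable. The creation integral is the operator $$\int^{\rm BL}F_t\,dA_t^*\,\psi=\tilde\delta(F_\cdot\psi),$$ with domain all $\psi\in\Gamma$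 such that $F_\cdot\psi\in L^2(\mathbb R_+;\Gamma)$ and $F_\cdot\psi\in\mathrm{Dom}\,\tilde\delta$. **Proposition.** Let $X=(X^1,X^2)\in\mathrm{Dom}\,\delta$. Then $$\int_{\mathbb R_+}X^1\,dP+\int_{\mathbb R_+}X^2\,dQ=\int^{\rm BL}_{\mathbb R_+}(X^2-iX^1)\,dA^*_t+\int^{\rm BL}_{\mathbb R_+}(X^2+iX^1)\,dA_t$$ in the following sense: the operator on the right-hand side, with domain the intersection of the domains of its two summands, is densely defined, its domain contains all exponential vectors, and on every vector of this domain it agrees with the bounded operator $\delta(X)$ on the left-hand side. -/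

import Mathlib

open MeasureTheory ENNReal
open scoped ComplexConjugate

noncomputable section

namespace WhiteNoise

variable {T : Type*} [MeasurableSpace T] (μ : Measure T) [SigmaFinite μ]

/-! ### The symmetric Fock space over `L²(T, μ; ℂ)` -/

/-- The one-particle space `L²(T, μ; ℂ)`, the complexification of the real space `L²(T, μ)`. -/
abbrev OneParticle : Type _ := Lp ℂ 2 μ

/-- The product measure `μⁿ` on `Tⁿ`. -/
abbrev powMeasure (n : ℕ) : Measure (Fin n → T) := Measure.pi fun _ => μ

/-- Permuting the coordinates of `Tⁿ` preserves `μⁿ`. -/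
theorem measurePreserving_perm (n : ℕ) (σ : Equiv.Perm (Fin n)) :
    MeasurePreserving (fun t : Fin n → T => t ∘ σ) (powMeasure μ n) (powMeasure μ n) := by
  have h := measurePreserving_piCongrLeft (α := fun _ : Fin n => T) (fun _ => μ) σ.symm
  convert h using 1
  funext t
  funext i
  simp [MeasurableEquiv.piCongrLeft, Equiv.piCongrLeft, Equiv.piCongrLeft']

/-- Permutation of the variables, as an isometry of `L²(Tⁿ, μⁿ; ℂ)`. -/
def permute (n : ℕ) (σ : Equiv.Perm (Fin n)) :
    Lp ℂ 2 (powMeasure μ n) →ₗᵢ[ℂ] Lp ℂ 2 (powMeasure μ n) :=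
  Lp.compMeasurePreservingₗᵢ ℂ (fun t : Fin n → T => t ∘ σ) (measurePreserving_perm μ n σ)

/-- The `n`-th symmetric Hilbert space tensor power of `L²(T, μ; ℂ)`, realised as the space of
symmetric functions in `L²(Tⁿ, μⁿ; ℂ)`. -/
def SymPower (n : ℕ) : Submodule ℂ (Lp ℂ 2 (powMeasure μ n)) where
  carrier := {f | ∀ σ : Equiv.Perm (Fin n), permute μ n σ f = f}
  add_mem' hf hg σ := by rw [map_add, hf σ, hg σ]
  zero_mem' σ := map_zero _
  smul_mem' c f hf σ := by rw [map_smul, hf σ]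

theorem isClosed_symPower (n : ℕ) :
    IsClosed (SymPower μ n : Set (Lp ℂ 2 (powMeasure μ n))) := by
  have : (SymPower μ n : Set (Lp ℂ 2 (powMeasure μ n))) =
      ⋂ σ : Equiv.Perm (Fin n), {f | permute μ n σ f = f} := by
    ext f
    simp [SymPower]
  rw [this]
  exact isClosed_iInter fun σ => isClosed_eq (permute μ n σ).continuous continuous_id

instance (n : ℕ) : CompleteSpace (SymPower μ n) := (isClosed_symPower μ n).completeSpace_coe

/-- The symmetric Fock space `Γ_s(L²(T, μ; ℂ))`: the Hilbert space direct sum of the symmetric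
tensor powers. -/
abbrev Fock : Type _ := lp (fun n : ℕ => SymPower μ n) 2

variable {μ}

theorem memLp_tensorPow (k : OneParticle μ) (n : ℕ) :
    MemLp (fun t : Fin n → T => ∏ i, k (t i)) 2 (powMeasure μ n) := by
  have hm : AEStronglyMeasurable (fun t : Fin n → T => ∏ i, k (t i)) (powMeasure μ n) := by
    refine Finset.aestronglyMeasurable_fun_prod _ fun i _ => ?_
    exact (Lp.aestronglyMeasurable k).comp_quasiMeasurePreserving
      (Measure.quasiMeasurePreserving_eval (fun _ : Fin n => μ) i)
  rw [memLp_two_iff_integrable_sq_norm hm]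
  have hk : Integrable (fun t => ‖k t‖ ^ 2) μ :=
    (memLp_two_iff_integrable_sq_norm (Lp.aestronglyMeasurable k)).1 (Lp.memLp k)
  have := Integrable.fintype_prod (𝕜 := ℝ) (μ := fun _ : Fin n => μ)
    (f := fun _ t => ‖k t‖ ^ 2) fun _ => hk
  simpa [norm_prod, Finset.prod_pow] using this

/-- The tensor power `k^{⊗n}`, the function `(t₁, …, tₙ) ↦ k(t₁) ⋯ k(tₙ)`. -/
def tensorPow (k : OneParticle μ) (n : ℕ) : SymPower μ n :=
  ⟨(memLp_tensorPow k n).toLp _, fun σ => by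
    have h : permute μ n σ ((memLp_tensorPow k n).toLp _) =
        ((memLp_tensorPow k n).comp_measurePreserving (measurePreserving_perm μ n σ)).toLp _ :=
      Lp.toLp_compMeasurePreserving _ _
    rw [h]
    congr 1
    funext t
    exact Equiv.prod_comp σ fun i => k (t i)⟩

theorem norm_tensorPow (k : OneParticle μ) (n : ℕ) : ‖tensorPow k n‖ = ‖k‖ ^ n := by
  have sq : ∀ {α : Type _} [MeasurableSpace α] (ν : Measure α) (f : Lp ℂ 2 ν),
      ‖f‖ ^ 2 = ∫ a, ‖f a‖ ^ 2 ∂ν := fun ν f => by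
    have h := L2.inner_def (𝕜 := ℂ) f f
    simp only [inner_self_eq_norm_sq_to_K] at h
    have h2 : ((‖f‖ ^ 2 : ℝ) : ℂ) = ((∫ a, ‖f a‖ ^ 2 ∂ν : ℝ) : ℂ) := by
      rw [← integral_complex_ofReal]
      simpa using h
    exact_mod_cast h2
  have h1 : ‖tensorPow k n‖ ^ 2 = (‖k‖ ^ n) ^ 2 := by
    rw [← pow_mul, mul_comm, pow_mul, sq μ k, Submodule.coe_norm, sq]
    have hae : (fun t => ‖((tensorPow k n : SymPower μ n) : Lp ℂ 2 (powMeasure μ n)) t‖ ^ 2)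
        =ᵐ[powMeasure μ n] fun t => ∏ i, ‖k (t i)‖ ^ 2 := by
      filter_upwards [(memLp_tensorPow k n).coeFn_toLp] with t ht
      change ‖((memLp_tensorPow k n).toLp _ : Lp ℂ 2 (powMeasure μ n)) t‖ ^ 2 = _
      rw [ht, norm_prod, Finset.prod_pow]
    rw [integral_congr_ae hae]
    simpa using integral_fintype_prod_eq_pow (ι := Fin n) (μ := μ) fun t => ‖k t‖ ^ 2
  exact (pow_left_inj₀ (norm_nonneg _) (by positivity) two_ne_zero).1 h1

theorem memℓp_expVec (k : OneParticle μ) :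
    Memℓp (fun n : ℕ => ((√(n.factorial : ℝ) : ℂ))⁻¹ • tensorPow k n) 2 := by
  refine memℓp_gen ?_
  have h := Real.summable_pow_div_factorial (‖k‖ ^ 2)
  refine h.congr fun n => ?_
  have hn : (0 : ℝ) ≤ (n.factorial : ℝ) := by positivity
  simp only [norm_smul, norm_inv, norm_tensorPow, ENNReal.toReal_ofNat, Real.rpow_ofNat,
    Complex.norm_real, Real.norm_eq_abs, abs_of_nonneg (Real.sqrt_nonneg _)]
  rw [mul_pow, inv_pow, Real.sq_sqrt hn, ← pow_mul, ← pow_mul, mul_comm n 2]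
  ring

/-- The exponential vector `ℰ(k) = ∑ₙ k^{⊗n} / √n!`. -/
def expVec (k : OneParticle μ) : Fock μ :=
  ⟨fun n : ℕ => ((√(n.factorial : ℝ) : ℂ))⁻¹ • tensorPow k n, memℓp_expVec k⟩

/-! ### Square integrable operator processes and the Hitsuda–Skorohod integral -/

/-- Bounded operators on the Fock space. -/
abbrev BoundedOp (μ : Measure T) [SigmaFinite μ] : Type _ := Fock μ →L[ℂ] Fock μ

/-- `X ∈ L²(T, B(Γ))`: the process `t ↦ X t` is measurable in the strong operator sense and
`∫ ‖X t‖² dμ(t) < ∞`. -/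
def IsL2Process (X : T → BoundedOp μ) : Prop :=
  (∀ ψ : Fock μ, AEStronglyMeasurable (fun t => X t ψ) μ) ∧ MemLp (fun t => ‖X t‖) 2 μ

/-- `M` has the matrix elements between exponential vectors that characterise
`δ(X) = ∫ X¹ dP + ∫ X² dQ`. -/
def IsDivergence (X : (T → BoundedOp μ) × (T → BoundedOp μ)) (M : BoundedOp μ) : Prop :=
  ∀ k₁ k₂ : OneParticle μ,
    inner ℂ (expVec k₁) (M (expVec k₂)) =
      ∫ t, (Complex.I * (k₂ t - conj (k₁ t)) * inner ℂ (expVec k₁) (X.1 t (expVec k₂)) +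
        (conj (k₁ t) + k₂ t) * inner ℂ (expVec k₁) (X.2 t (expVec k₂))) ∂μ

variable (μ) in
/-- The domain of the divergence operator `δ`, i.e. the Hitsuda–Skorohod integrable processes. -/
def divergenceDomain : Set ((T → BoundedOp μ) × (T → BoundedOp μ)) :=
  {X | IsL2Process X.1 ∧ IsL2Process X.2 ∧ ∃ M : BoundedOp μ, IsDivergence X M}

/-! ### The classical derivation and divergence on the Fock space -/

variable (μ) in
/-- `Γ ⊗ L²(T, μ; ℂ)`, realised as `L²(T, μ; Γ)`. -/
abbrev FockField : Type _ := Lp (Fock μ) 2 μ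

theorem memLp_smul_expVec (k : OneParticle μ) : MemLp (fun t => k t • expVec k) 2 μ :=
  (ContinuousLinearMap.toSpanSingleton ℂ (expVec k)).comp_memLp' (Lp.memLp k)

/-- `ℰ(k) ⊗ k`, i.e. the function `t ↦ k(t) ℰ(k)`. -/
def expField (k : OneParticle μ) : FockField μ := (memLp_smul_expVec k).toLp _

variable (μ) in
/-- The derivation operator `D̃ : Γ → Γ ⊗ L²(T, μ; ℂ)`: the closure of the operator acting on the
linear span of the exponential vectors by `D̃ ℰ(k) = ℰ(k) ⊗ k`. -/
def gradient : Fock μ →ₗ.[ℂ] FockField μ :=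
  (Submodule.span ℂ
    (Set.range fun k : OneParticle μ => (expVec k, expField k))).topologicalClosure.toLinearPMap

variable (μ) in
/-- The classical divergence operator `δ̃`, the adjoint of `D̃`. -/
def skorohod : FockField μ →ₗ.[ℂ] Fock μ := (gradient μ).adjoint

/-! ### The Belavkin–Lindsay integrals -/

theorem gradient_integrand_add (F : T → BoundedOp μ) {ψ φ : Fock μ}
    (hψ : ψ ∈ (gradient μ).domain) (hφ : φ ∈ (gradient μ).domain) :
    (fun t => F t (gradient μ ⟨ψ + φ, add_mem hψ hφ⟩ t)) =ᵐ[μ]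
      fun t => F t (gradient μ ⟨ψ, hψ⟩ t) + F t (gradient μ ⟨φ, hφ⟩ t) := by
  have h : gradient μ ⟨ψ + φ, add_mem hψ hφ⟩ = gradient μ ⟨ψ, hψ⟩ + gradient μ ⟨φ, hφ⟩ :=
    map_add (gradient μ).toFun ⟨ψ, hψ⟩ ⟨φ, hφ⟩
  filter_upwards [Lp.coeFn_add (gradient μ ⟨ψ, hψ⟩) (gradient μ ⟨φ, hφ⟩)] with t ht
  rw [h, ht, Pi.add_apply, map_add]

theorem gradient_integrand_smul (F : T → BoundedOp μ) (c : ℂ) {ψ : Fock μ}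
    (hψ : ψ ∈ (gradient μ).domain) :
    (fun t => F t (gradient μ ⟨c • ψ, Submodule.smul_mem _ c hψ⟩ t)) =ᵐ[μ]
      fun t => c • F t (gradient μ ⟨ψ, hψ⟩ t) := by
  have h : gradient μ ⟨c • ψ, Submodule.smul_mem _ c hψ⟩ = c • gradient μ ⟨ψ, hψ⟩ :=
    map_smul (gradient μ).toFun c ⟨ψ, hψ⟩
  filter_upwards [Lp.coeFn_smul c (gradient μ ⟨ψ, hψ⟩)] with t ht
  rw [h, ht, Pi.smul_apply, map_smul]

/-- The annihilation integral `∫ F_t dA_t`: it maps `ψ` to the Bochner integral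
`∫ F_t (D̃ψ)_t dμ(t)`, and its domain consists of all `ψ ∈ Dom D̃` for which the integrand is
Bochner integrable. -/
def annihilationIntegral (F : T → BoundedOp μ) : Fock μ →ₗ.[ℂ] Fock μ where
  domain :=
    { carrier := {ψ | ∃ h : ψ ∈ (gradient μ).domain,
        Integrable (fun t => F t (gradient μ ⟨ψ, h⟩ t)) μ}
      add_mem' := by
        rintro ψ φ ⟨hψ, iψ⟩ ⟨hφ, iφ⟩
        exact ⟨add_mem hψ hφ, (iψ.add iφ).congr (gradient_integrand_add F hψ hφ).symm⟩
      zero_mem' := ⟨zero_mem _, (integrable_zero T (Fock μ) μ).congr (by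
        have h0 : gradient μ ⟨0, zero_mem _⟩ = 0 := map_zero (gradient μ).toFun
        filter_upwards [Lp.coeFn_zero (Fock μ) 2 μ] with t ht
        rw [h0, ht]
        simp)⟩
      smul_mem' := by
        rintro c ψ ⟨hψ, iψ⟩
        exact ⟨Submodule.smul_mem _ c hψ,
          (iψ.smul c).congr (gradient_integrand_smul F c hψ).symm⟩ }
  toFun :=
    { toFun := fun ψ => ∫ t, F t (gradient μ ⟨ψ, ψ.2.1⟩ t) ∂μ
      map_add' := fun ψ φ =>
        (integral_congr_ae (gradient_integrand_add F ψ.2.1 φ.2.1)).trans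
          (integral_add ψ.2.2 φ.2.2)
      map_smul' := fun c ψ =>
        (integral_congr_ae (gradient_integrand_smul F c ψ.2.1)).trans (integral_smul c _) }

theorem toLp_process_add (F : T → BoundedOp μ) {ψ φ : Fock μ}
    (hψ : MemLp (fun t => F t ψ) 2 μ) (hφ : MemLp (fun t => F t φ) 2 μ)
    (h : MemLp (fun t => F t (ψ + φ)) 2 μ) : h.toLp _ = hψ.toLp _ + hφ.toLp _ := by
  rw [← MemLp.toLp_add hψ hφ]
  congr 1
  funext t
  simp

theorem toLp_process_smul (F : T → BoundedOp μ) (c : ℂ) {ψ : Fock μ}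
    (hψ : MemLp (fun t => F t ψ) 2 μ) (h : MemLp (fun t => F t (c • ψ)) 2 μ) :
    h.toLp _ = c • hψ.toLp _ := by
  rw [← MemLp.toLp_const_smul c hψ]
  congr 1
  funext t
  simp

/-- The creation integral `∫ F_t dA*_t`: it maps `ψ` to `δ̃(F_· ψ)`, and its domain consists of all
`ψ` for which `t ↦ F_t ψ` is square integrable and belongs to `Dom δ̃`. -/
def creationIntegral (F : T → BoundedOp μ) : Fock μ →ₗ.[ℂ] Fock μ where
  domain :=
    { carrier := {ψ | ∃ h : MemLp (fun t => F t ψ) 2 μ, h.toLp _ ∈ (skorohod μ).domain}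
      add_mem' := by
        rintro ψ φ ⟨hψ, dψ⟩ ⟨hφ, dφ⟩
        have h : MemLp (fun t => F t (ψ + φ)) 2 μ := by
          simp only [map_add]
          exact hψ.add hφ
        refine ⟨h, ?_⟩
        rw [toLp_process_add F hψ hφ h]
        exact add_mem dψ dφ
      zero_mem' := by
        have h : MemLp (fun t => F t (0 : Fock μ)) 2 μ := by simp
        refine ⟨h, ?_⟩
        have h0 : h.toLp _ = 0 := by
          refine Lp.ext (h.coeFn_toLp.trans ?_)
          filter_upwards [Lp.coeFn_zero (Fock μ) 2 μ] with t ht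
          rw [ht]
          simp
        rw [h0]
        exact zero_mem _
      smul_mem' := by
        rintro c ψ ⟨hψ, dψ⟩
        have h : MemLp (fun t => F t (c • ψ)) 2 μ := by
          simp only [map_smul]
          exact hψ.const_smul c
        refine ⟨h, ?_⟩
        rw [toLp_process_smul F c hψ h]
        exact Submodule.smul_mem _ c dψ }
  toFun :=
    { toFun := fun ψ => skorohod μ ⟨ψ.2.1.toLp _, ψ.2.2⟩
      map_add' := fun ψ φ =>
        (congrArg (skorohod μ)
          (Subtype.ext (toLp_process_add F ψ.2.1 φ.2.1 (ψ + φ).2.1))).trans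
          (map_add (skorohod μ).toFun ⟨ψ.2.1.toLp _, ψ.2.2⟩ ⟨φ.2.1.toLp _, φ.2.2⟩)
      map_smul' := fun c ψ =>
        (congrArg (skorohod μ)
          (Subtype.ext (toLp_process_smul F c ψ.2.1 (c • ψ).2.1))).trans
          (map_smul (skorohod μ).toFun c ⟨ψ.2.1.toLp _, ψ.2.2⟩) }

/-- Lebesgue measure on the half-line `ℝ₊ = [0, ∞)`. -/
abbrev halfLine : Measure ℝ := volume.restrict (Set.Ici 0)

end WhiteNoise

end

open WhiteNoise

/-!
Put `F = X² - iX¹` and `G = X² + iX¹`, and let `D̃` be the derivation, with `D̃ℰ(k) = ℰ(k) ⊗ k`.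
Collecting the terms with `conj k₁` and with `k₂` in the relation that defines `M = δ(X)` gives
`⟨ℰ(k₁), M ℰ(k₂)⟩ = ⟨D̃ℰ(k₁), F_· ℰ(k₂)⟩ + ⟨ℰ(k₁), ∫ G_t (D̃ℰ(k₂))_t dμ(t)⟩`.
By the Cauchy–Schwarz inequality the operators `ψ ↦ F_· ψ` and `η ↦ ∫ G_t η_t dμ(t)` are bounded
between `Γ` and `L²(T, μ; Γ)` (`exists_processApply`, `exists_processIntegral`), so both sides are
continuous for the graph norm of `D̃`, and the identity extends from exponential vectors to
`⟨φ, M ψ⟩ = ⟨D̃φ, F_· ψ⟩ + ⟨φ, ∫ G_t (D̃ψ)_t dμ(t)⟩` for all `φ, ψ ∈ Dom D̃`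
(`IsDivergence.inner_eq`). For fixed `ψ` this says that `F_· ψ ∈ Dom D̃*` and
`D̃* (F_· ψ) = M ψ - ∫ G_t (D̃ψ)_t dμ(t)`. Hence the common domain of the two Belavkin–Lindsay
integrals is exactly `Dom D̃`, and their sum is the restriction of `M` to it.

Two facts about the Fock space are needed for `D̃` and its adjoint to be what they should be.

* The exponential vectors are total (`dense_span_expVec`). If `f` is orthogonal to all `ℰ(zk)`, then
  comparing powers of `z` shows that each component of `f` is orthogonal to all `k^{⊗n}`.
  Polarization, in the form of the `n`-th derivative of `k ↦ ⟨f, k^{⊗n}⟩`, makes it orthogonal to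
  all products `v₁ ⊗ ⋯ ⊗ vₙ`, in particular to the indicators of boxes, so that it vanishes.
* `D̃` is closable (`gradientGraph_snd_eq_zero`). Its adjoint is defined on the total set of
  functions `1_A ⊗ ℰ(g)`, which it maps to the derivative of `z ↦ ℰ(g + z 1_A)` at `0`. That
  derivative is obtained as a Cauchy integral, which requires only the continuity of `ℰ` and the
  formula `⟨ℰ(k), ℰ(l)⟩ = exp ⟨k, l⟩`.

All this holds over an arbitrary σ-finite measure space `(T, μ)`.
-/

namespace WhiteNoise

/-! ### Tensor products of functions in `L²(T, μ; ℂ)` -/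

theorem prod_update_apply {T : Type*} [MeasurableSpace T] {μ : Measure T} {n : ℕ}
    (v : Fin n → OneParticle μ) (i : Fin n) (z : OneParticle μ) (t : Fin n → T) :
    ∏ j, Function.update v i z j (t j) = z (t i) * ∏ j ∈ Finset.univ.erase i, v j (t j) := by
  rw [← Finset.mul_prod_erase _ _ (Finset.mem_univ i), Function.update_self]
  congr 1
  refine Finset.prod_congr rfl fun j hj => ?_
  rw [Function.update_of_ne (Finset.ne_of_mem_erase hj)]

variable {T : Type*} [MeasurableSpace T] {μ : Measure T} [SigmaFinite μ]

theorem memLp_tensorProd {n : ℕ} (v : Fin n → OneParticle μ) :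
    MemLp (fun t : Fin n → T => ∏ i, v i (t i)) 2 (powMeasure μ n) := by
  have hm : AEStronglyMeasurable (fun t : Fin n → T => ∏ i, v i (t i)) (powMeasure μ n) := by
    refine Finset.aestronglyMeasurable_fun_prod _ fun i _ => ?_
    exact (Lp.aestronglyMeasurable (v i)).comp_quasiMeasurePreserving
      (Measure.quasiMeasurePreserving_eval (fun _ : Fin n => μ) i)
  rw [memLp_two_iff_integrable_sq_norm hm]
  have := Integrable.fintype_prod (𝕜 := ℝ) (μ := fun _ : Fin n => μ)
    (f := fun i t => ‖v i t‖ ^ 2)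
    fun i => (memLp_two_iff_integrable_sq_norm (Lp.aestronglyMeasurable (v i))).1 (Lp.memLp (v i))
  simpa [norm_prod, Finset.prod_pow] using this

/-- The tensor product `v₁ ⊗ ⋯ ⊗ vₙ`, the function `(t₁, …, tₙ) ↦ v₁(t₁) ⋯ vₙ(tₙ)`; it is not
symmetrised. -/
noncomputable def tensorProd {n : ℕ} (v : Fin n → OneParticle μ) : Lp ℂ 2 (powMeasure μ n) :=
  (memLp_tensorProd v).toLp _

theorem coeFn_tensorProd {n : ℕ} (v : Fin n → OneParticle μ) :
    tensorProd v =ᵐ[powMeasure μ n] fun t => ∏ i, v i (t i) :=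
  (memLp_tensorProd v).coeFn_toLp

theorem coe_tensorPow (k : OneParticle μ) (n : ℕ) :
    (tensorPow k n : Lp ℂ 2 (powMeasure μ n)) = tensorProd fun _ => k := rfl

theorem inner_tensorProd {n : ℕ} (v w : Fin n → OneParticle μ) :
    inner ℂ (tensorProd v) (tensorProd w) = ∏ i, inner ℂ (v i) (w i) := by
  simp only [L2.inner_def]
  rw [← integral_fintype_prod_eq_prod (𝕜 := ℂ) (μ := fun _ : Fin n => μ)
    fun i t => inner ℂ (v i t) (w i t)]
  refine integral_congr_ae ?_
  filter_upwards [coeFn_tensorProd v, coeFn_tensorProd w] with t hv hw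
  simp [hv, hw, Finset.prod_mul_distrib, map_prod]

theorem norm_tensorProd {n : ℕ} (v : Fin n → OneParticle μ) :
    ‖tensorProd v‖ = ∏ i, ‖v i‖ := by
  have h := inner_tensorProd v v
  simp only [inner_self_eq_norm_sq_to_K, Finset.prod_pow] at h
  have h2 : ‖tensorProd v‖ ^ 2 = (∏ i, ‖v i‖) ^ 2 := by exact_mod_cast h
  exact (pow_left_inj₀ (norm_nonneg _) (by positivity) two_ne_zero).1 h2

theorem ae_eval {n : ℕ} (i : Fin n) {p : T → Prop} (h : ∀ᵐ t ∂μ, p t) :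
    ∀ᵐ t ∂powMeasure μ n, p (t i) :=
  (Measure.quasiMeasurePreserving_eval (fun _ : Fin n => μ) i).ae h

theorem tensorProd_update_add {n : ℕ} (v : Fin n → OneParticle μ) (i : Fin n)
    (x y : OneParticle μ) :
    tensorProd (Function.update v i (x + y)) =
      tensorProd (Function.update v i x) + tensorProd (Function.update v i y) := by
  refine Lp.ext ?_
  filter_upwards [coeFn_tensorProd (Function.update v i (x + y)),
    coeFn_tensorProd (Function.update v i x), coeFn_tensorProd (Function.update v i y),
    Lp.coeFn_add (tensorProd (Function.update v i x)) (tensorProd (Function.update v i y)),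
    ae_eval i (Lp.coeFn_add x y)] with t h1 h2 h3 h4 h5
  rw [h4, Pi.add_apply, h1, h2, h3, prod_update_apply, prod_update_apply, prod_update_apply,
    h5, Pi.add_apply, add_mul]

theorem tensorProd_update_smul {n : ℕ} (v : Fin n → OneParticle μ) (i : Fin n)
    (c : ℂ) (x : OneParticle μ) :
    tensorProd (Function.update v i (c • x)) = c • tensorProd (Function.update v i x) := by
  refine Lp.ext ?_
  filter_upwards [coeFn_tensorProd (Function.update v i (c • x)),
    coeFn_tensorProd (Function.update v i x),
    Lp.coeFn_smul c (tensorProd (Function.update v i x)),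
    ae_eval i (Lp.coeFn_smul c x)] with t h1 h2 h4 h5
  rw [h4, Pi.smul_apply, h1, h2, prod_update_apply, prod_update_apply, h5, Pi.smul_apply,
    smul_eq_mul, smul_eq_mul, mul_assoc]

variable (μ) in
/-- The map `(v₁, …, vₙ) ↦ v₁ ⊗ ⋯ ⊗ vₙ` as a continuous multilinear map. -/
noncomputable def tensorProdCMM (n : ℕ) :
    ContinuousMultilinearMap ℂ (fun _ : Fin n => OneParticle μ) (Lp ℂ 2 (powMeasure μ n)) :=
  MultilinearMap.mkContinuous
    (MultilinearMap.mk' (fun v => tensorProd v) (fun v => tensorProd_update_add v)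
      (fun v => tensorProd_update_smul v)) 1
    fun v => by simp [norm_tensorProd]

@[simp]
theorem tensorProdCMM_apply {n : ℕ} (v : Fin n → OneParticle μ) :
    tensorProdCMM μ n v = tensorProd v := rfl

theorem permute_tensorProd {n : ℕ} (σ : Equiv.Perm (Fin n)) (v : Fin n → OneParticle μ) :
    permute μ n σ (tensorProd v) = tensorProd fun i => v (σ.symm i) := by
  have h : permute μ n σ (tensorProd v) =
      ((memLp_tensorProd v).comp_measurePreserving (measurePreserving_perm μ n σ)).toLp _ :=
    Lp.toLp_compMeasurePreserving _ _
  rw [h]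
  refine Lp.ext ?_
  filter_upwards [((memLp_tensorProd v).comp_measurePreserving
    (measurePreserving_perm μ n σ)).coeFn_toLp, coeFn_tensorProd fun i => v (σ.symm i)]
    with t h1 h2
  rw [h1, h2, ← Equiv.prod_comp σ]
  simp

/-! ### Totality of the tensor powers and of the exponential vectors -/

/-- An integrable function on a finite product space vanishes almost everywhere if its integral over
every measurable box does. -/
theorem ae_eq_zero_of_forall_setIntegral_pi_eq_zero {n : ℕ} {ν : Measure (Fin n → T)}
    {f : (Fin n → T) → ℂ} (hf : Integrable f ν)
    (h : ∀ A : Fin n → Set T, (∀ i, MeasurableSet (A i)) →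
      ∫ t in Set.univ.pi A, f t ∂ν = 0) : f =ᵐ[ν] 0 := by
  refine hf.ae_eq_zero_of_forall_setIntegral_eq_zero fun s hs hlt => ?_
  clear hlt
  have huniv : ∫ t, f t ∂ν = 0 := by
    simpa using h (fun _ => Set.univ) fun _ => MeasurableSet.univ
  induction s, hs using MeasurableSpace.induction_on_inter
    (generateFrom_pi (α := fun _ : Fin n => T)).symm isPiSystem_pi with
  | empty => simp
  | basic s hs =>
    obtain ⟨A, hA, rfl⟩ := hs
    exact h A fun i => hA i (Set.mem_univ i)
  | compl s hs ih =>
    have := integral_add_compl hs hf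
    simpa [ih, huniv] using this
  | iUnion s hd hs ih =>
    rw [integral_iUnion hs hd hf.integrableOn]
    simp [ih]

/-- The tensor products `v₁ ⊗ ⋯ ⊗ vₙ` are total in `L²(Tⁿ, μⁿ; ℂ)`: those of indicators of sets of
finite measure are the indicators of boxes. -/
theorem eq_zero_of_forall_inner_tensorProd {n : ℕ} (f : Lp ℂ 2 (powMeasure μ n))
    (h : ∀ v : Fin n → OneParticle μ, inner ℂ (tensorProd v) f = 0) : f = 0 := by
  -- `Tⁿ` is exhausted by boxes of finite measure, on which `f` is integrable.
  let B : ℕ → Set (Fin n → T) := fun N => Set.univ.pi fun _ => spanningSets μ N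
  have hB : ∀ᵐ t ∂(powMeasure μ n).restrict (⋃ N, B N), f t = 0 := by
    refine (ae_restrict_iUnion_iff _ _).2 fun N => ?_
    refine ae_eq_zero_of_forall_setIntegral_pi_eq_zero (n := n)
      (integrableOn_Lp_of_measure_ne_top f fact_one_le_two_ennreal.elim ?_) fun A hA => ?_
    · rw [Measure.pi_pi]
      exact ENNReal.prod_ne_top fun i _ => (measure_spanningSets_lt_top μ N).ne
    have hm : ∀ i, MeasurableSet (A i ∩ spanningSets μ N) := fun i =>
      (hA i).inter (measurableSet_spanningSets μ N)
    have hfin : ∀ i, μ (A i ∩ spanningSets μ N) ≠ ∞ := fun i =>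
      ((measure_mono Set.inter_subset_right).trans_lt (measure_spanningSets_lt_top μ N)).ne
    have hbox : Set.univ.pi A ∩ B N = Set.univ.pi fun i => A i ∩ spanningSets μ N :=
      Set.pi_inter_distrib.symm
    rw [Measure.restrict_restrict (MeasurableSet.univ_pi hA), hbox,
      ← integral_indicator (MeasurableSet.univ_pi hm),
      ← h fun i => indicatorConstLp 2 (hm i) (hfin i) 1, L2.inner_def]
    refine integral_congr_ae ?_
    filter_upwards [coeFn_tensorProd fun i => indicatorConstLp 2 (hm i) (hfin i) (1 : ℂ),
      ae_all_iff.2 fun i => ae_eval i (indicatorConstLp_coeFn (p := 2) (hs := hm i)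
        (hμs := hfin i) (c := (1 : ℂ)))] with t h1 h2
    rw [h1]
    simp only [h2]
    by_cases ht : t ∈ Set.univ.pi fun i => A i ∩ spanningSets μ N
    · have : ∀ i, t i ∈ A i ∩ spanningSets μ N := fun i => ht i (Set.mem_univ i)
      simp only [Set.indicator_of_mem ht, Set.indicator_of_mem (this _)]
      simp
    · obtain ⟨i, hi⟩ : ∃ i, t i ∉ A i ∩ spanningSets μ N := by
        by_contra! hc
        exact ht fun i _ => hc i
      rw [Set.indicator_of_notMem ht,
        Finset.prod_eq_zero (Finset.mem_univ i) (Set.indicator_of_notMem hi _), inner_zero_left]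
  have hU : ⋃ N, B N = Set.univ := by
    rw [Set.iUnion_univ_pi_of_monotone fun _ => monotone_spanningSets μ]
    simp [iUnion_spanningSets]
  rw [hU, Measure.restrict_univ] at hB
  exact (Lp.eq_zero_iff_ae_eq_zero).2 hB

/-- A symmetric function orthogonal to all tensor powers `k^{⊗n}` vanishes: by polarization it is
orthogonal to all tensor products `v₁ ⊗ ⋯ ⊗ vₙ`. -/
theorem eq_zero_of_forall_inner_tensorPow {n : ℕ} (f : SymPower μ n)
    (h : ∀ k : OneParticle μ, inner ℂ f (tensorPow k n) = 0) : f = 0 := by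
  refine Subtype.ext (eq_zero_of_forall_inner_tensorProd _ fun v => ?_)
  let F : ContinuousMultilinearMap ℂ (fun _ : Fin n => OneParticle μ) ℂ :=
    (innerSL ℂ (f : Lp ℂ 2 (powMeasure μ n))).compContinuousMultilinearMap (tensorProdCMM μ n)
  have hF : ∀ w, F w = inner ℂ (f : Lp ℂ 2 (powMeasure μ n)) (tensorProd w) := fun w => rfl
  have hdiag : (fun k : OneParticle μ => F fun _ => k) = 0 := funext h
  have hsymm : ∀ σ : Equiv.Perm (Fin n), F (fun i => v (σ i)) = F v := fun σ => by
    have h1 := (permute μ n σ.symm).inner_map_map (f : Lp ℂ 2 (powMeasure μ n)) (tensorProd v)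
    rw [f.2 σ.symm, permute_tensorProd] at h1
    exact h1
  -- The `n`-th derivative of `k ↦ F(k, …, k) = 0` is the sum of `F` over all permutations of its
  -- arguments, which is `n! F(v)` by symmetry.
  have hpol := F.iteratedFDeriv_comp_diagonal 0 v
  rw [hdiag] at hpol
  simp only [hsymm, Finset.sum_const] at hpol
  have h0 : F v = 0 := by
    have hz : iteratedFDeriv ℂ n (0 : OneParticle μ → ℂ) 0 v = 0 := by
      rw [show (0 : OneParticle μ → ℂ) = fun _ => 0 from rfl, iteratedFDeriv_fun_zero]
      rfl
    rw [hz] at hpol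
    have := hpol.symm
    simpa [Fintype.card_perm, Nat.factorial_ne_zero] using this
  rw [← inner_conj_symm, ← hF, h0, map_zero]

theorem tensorPow_smul (z : ℂ) (k : OneParticle μ) (n : ℕ) :
    tensorPow (z • k) n = z ^ n • tensorPow k n := by
  refine Subtype.ext ?_
  have := (tensorProdCMM μ n).map_smul_univ (fun _ => z) (fun _ => k)
  simpa [coe_tensorPow] using this

/-- A vector orthogonal to all exponential vectors vanishes: `z ↦ ⟨f, ℰ(zk)⟩` is a power series
whose coefficients are the inner products of the components of `f` with the `k^{⊗n}`. -/
theorem eq_zero_of_forall_inner_expVec (f : Fock μ)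
    (h : ∀ k : OneParticle μ, inner ℂ f (expVec k) = 0) : f = 0 := by
  refine lp.ext (funext fun n => eq_zero_of_forall_inner_tensorPow _ fun k => ?_)
  let a : ℕ → ℂ := fun m => (√(m.factorial : ℝ) : ℂ)⁻¹ * inner ℂ (f m) (tensorPow k m)
  let p : FormalMultilinearSeries ℂ ℂ ℂ := fun m =>
    ContinuousMultilinearMap.mkPiRing ℂ (Fin m) (a m)
  have hp : HasFPowerSeriesAt (0 : ℂ → ℂ) p 0 := by
    rw [hasFPowerSeriesAt_iff]
    refine Filter.Eventually.of_forall fun z => ?_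
    have hs := lp.hasSum_inner (𝕜 := ℂ) f (expVec (z • k))
    rw [h] at hs
    refine hs.congr_fun fun m => ?_
    simp [p, a, expVec, tensorPow_smul, FormalMultilinearSeries.coeff, inner_smul_right]
    ring
  have hpn : p n = 0 := by rw [hp.eq_zero]; rfl
  have ha : a n = 0 := ContinuousMultilinearMap.mkPiRing_eq_zero_iff _ |>.1 hpn
  have hn : (√(n.factorial : ℝ) : ℂ)⁻¹ ≠ 0 := by
    have : √(n.factorial : ℝ) ≠ 0 := by positivity
    simpa using this
  exact (mul_eq_zero.1 ha).resolve_left hn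

variable (μ) in
/-- The exponential vectors are total in the Fock space. -/
theorem dense_span_expVec :
    Dense (Submodule.span ℂ (Set.range (expVec (μ := μ))) : Set (Fock μ)) := by
  rw [Submodule.dense_iff_topologicalClosure_eq_top,
    Submodule.topologicalClosure_eq_top_iff, Submodule.eq_bot_iff]
  intro f hf
  exact eq_zero_of_forall_inner_expVec f fun k =>
    (Submodule.mem_orthogonal' _ _).1 hf _ (Submodule.subset_span ⟨k, rfl⟩)

/-! ### Inner products and continuity of exponential vectors -/

theorem inner_expVec (k l : OneParticle μ) :
    inner ℂ (expVec k) (expVec l) = Complex.exp (inner ℂ k l) := by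
  have h := lp.hasSum_inner (𝕜 := ℂ) (expVec k) (expVec l)
  rw [Complex.exp_eq_exp_ℂ]
  refine h.unique ?_
  refine (NormedSpace.expSeries_div_hasSum_exp (inner ℂ k l)).congr_fun fun n => ?_
  have hpow : inner ℂ (tensorPow k n) (tensorPow l n) = inner ℂ k l ^ n := by
    simp [Submodule.coe_inner, coe_tensorPow, inner_tensorProd]
  have hsq : ((√(n.factorial : ℝ) : ℝ) : ℂ) * (√(n.factorial : ℝ) : ℝ) = n.factorial := by
    rw [← Complex.ofReal_mul, Real.mul_self_sqrt (by positivity)]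
    simp
  have hsmul : ∀ c : ℂ, inner ℂ (c • tensorPow k n) (c • tensorPow l n) =
      conj c * (c * inner ℂ k l ^ n) := fun c => by
    simp only [Submodule.coe_inner, Submodule.coe_smul, inner_smul_left,
      inner_smul_right] at hpow ⊢
    rw [hpow, mul_left_comm]
  refine (hsmul _).trans ?_
  rw [map_inv₀, Complex.conj_ofReal, ← mul_assoc, ← mul_inv, hsq, div_eq_inv_mul]

theorem continuous_expVec : Continuous (expVec (μ := μ)) := by
  rw [continuous_iff_continuousAt]
  intro k
  have hsq : ∀ l : OneParticle μ, ‖expVec l - expVec k‖ ^ 2 =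
      RCLike.re (Complex.exp (inner ℂ l l) - Complex.exp (inner ℂ l k)
        - Complex.exp (inner ℂ k l) + Complex.exp (inner ℂ k k)) := fun l => by
    rw [← inner_self_eq_norm_sq (𝕜 := ℂ), inner_sub_left, inner_sub_right, inner_sub_right]
    simp only [inner_expVec]
    congr 1
    ring
  have hsq0 : Filter.Tendsto (fun l : OneParticle μ => ‖expVec l - expVec k‖ ^ 2)
      (nhds k) (nhds 0) := by
    simp only [hsq]
    have hc : Continuous fun l : OneParticle μ => RCLike.re (Complex.exp (inner ℂ l l) -
        Complex.exp (inner ℂ l k) - Complex.exp (inner ℂ k l) + Complex.exp (inner ℂ k k)) := by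
      fun_prop
    simpa using hc.tendsto k
  rw [ContinuousAt, tendsto_iff_norm_sub_tendsto_zero]
  simpa [Function.comp_def] using (Real.continuous_sqrt.tendsto 0).comp hsq0

/-! ### Closability of the derivation -/

/-- The vector obtained by applying the creation operator of `h` to `ℰ(g)`. It is the derivative at
`z = 0` of `z ↦ ℰ(g + zh)`, written as a Cauchy integral. -/
theorem exists_inner_expVec_eq_inner_mul_exp (g h : OneParticle μ) :
    ∃ v : Fock μ, ∀ k : OneParticle μ,
      inner ℂ (expVec k) v = inner ℂ k h * Complex.exp (inner ℂ k g) := by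
  refine ⟨(2 * Real.pi * Complex.I : ℂ)⁻¹ •
    ∮ z in C(0, 1), ((z - 0) ^ 2)⁻¹ • expVec (g + z • h), fun k => ?_⟩
  have hcomm : inner ℂ (expVec k) (∮ z in C(0, 1), ((z - 0) ^ 2)⁻¹ • expVec (g + z • h)) =
      ∮ z in C(0, 1), ((z - 0) ^ 2)⁻¹ • Complex.exp (inner ℂ k (g + z • h)) := by
    simp only [circleIntegral]
    rw [← innerSL_apply_apply ℂ, ← ContinuousLinearMap.intervalIntegral_comp_comm]
    · simp [inner_expVec]
    · refine ContinuousOn.intervalIntegrable (Continuous.continuousOn ?_)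
      have hcirc := continuous_circleMap (0 : ℂ) 1
      have hE : Continuous fun θ : ℝ => expVec (g + circleMap 0 1 θ • h) :=
        continuous_expVec.comp (by fun_prop)
      have hinv : Continuous fun θ : ℝ => ((circleMap 0 1 θ - 0) ^ 2 : ℂ)⁻¹ :=
        ((hcirc.sub continuous_const).pow 2).inv₀ fun θ => by simp
      simp only [deriv_circleMap]
      exact (hcirc.mul continuous_const).smul (hinv.smul hE)
  have hderiv : HasDerivAt (fun z : ℂ => Complex.exp (inner ℂ k (g + z • h)))
      (inner ℂ k h * Complex.exp (inner ℂ k g)) 0 := by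
    have h1 : HasDerivAt (fun z : ℂ => inner ℂ k g + z * inner ℂ k h) (inner ℂ k h) 0 := by
      simpa using ((hasDerivAt_id (0 : ℂ)).mul_const (inner ℂ k h)).const_add (inner ℂ k g)
    have h2 := h1.cexp
    simp only [inner_add_right, inner_smul_right]
    simpa [mul_comm] using h2
  have hdiff : Differentiable ℂ fun z : ℂ => Complex.exp (inner ℂ k (g + z • h)) := by
    simp only [inner_add_right, inner_smul_right]
    fun_prop
  rw [inner_smul_right, hcomm, ← hderiv.deriv, ← smul_eq_mul]
  exact Complex.two_pi_I_inv_smul_circleIntegral_sub_sq_inv_smul_of_differentiable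
    isOpen_univ (Set.subset_univ _) hdiff.differentiableOn (by simp)

variable (μ) in
/-- The graph of the derivation: the closed span of the pairs `(ℰ(k), ℰ(k) ⊗ k)`. -/
noncomputable abbrev gradientGraph : Submodule ℂ (Fock μ × FockField μ) :=
  (Submodule.span ℂ
    (Set.range fun k : OneParticle μ => (expVec k, expField k))).topologicalClosure

theorem coeFn_expField (k : OneParticle μ) : expField k =ᵐ[μ] fun t => k t • expVec k :=
  (memLp_smul_expVec k).coeFn_toLp

theorem expVec_expField_mem (k : OneParticle μ) : (expVec k, expField k) ∈ gradientGraph μ :=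
  Submodule.le_topologicalClosure _ (Submodule.subset_span ⟨k, rfl⟩)

/-- Two continuous linear maps which agree on the pairs `(ℰ(k), ℰ(k) ⊗ k)` agree on the graph of
the derivation. -/
theorem eq_of_mem_gradientGraph {L L' : Fock μ × FockField μ →L[ℂ] ℂ}
    (h : ∀ k : OneParticle μ, L (expVec k, expField k) = L' (expVec k, expField k))
    {p : Fock μ × FockField μ} (hp : p ∈ gradientGraph μ) : L p = L' p := by
  have hle : gradientGraph μ ≤ (L - L').ker := by
    refine Submodule.topologicalClosure_minimal _ (Submodule.span_le.2 ?_)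
      (L - L').isClosed_ker
    rintro _ ⟨k, rfl⟩
    simp [h k]
  simpa [sub_eq_zero] using hle hp

/-- The derivation is closable: the functions `1_A ⊗ ℰ(g)` are total in `L²(T, μ; Γ)`, and the
adjoint of the derivation is defined on them. -/
theorem gradientGraph_snd_eq_zero (p : Fock μ × FockField μ) (hp : p ∈ gradientGraph μ)
    (h0 : p.1 = 0) : p.2 = 0 := by
  refine (Lp.eq_zero_iff_ae_eq_zero).2 (Lp.ae_eq_zero_of_forall_setIntegral_eq_zero p.2
    two_ne_zero ENNReal.ofNat_ne_top
    (fun s _ hs => integrableOn_Lp_of_measure_ne_top _ fact_one_le_two_ennreal.elim hs.ne)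
    fun A hA hμA => ?_)
  refine eq_zero_of_forall_inner_expVec _ fun g => ?_
  rw [← inner_conj_symm, ← L2.inner_indicatorConstLp_eq_inner_setIntegral ℂ hA hμA.ne]
  let h : OneParticle μ := indicatorConstLp 2 hA hμA.ne (1 : ℂ)
  obtain ⟨v, hv⟩ := exists_inner_expVec_eq_inner_mul_exp g h
  have key := eq_of_mem_gradientGraph
    (L := (innerSL ℂ (indicatorConstLp 2 hA hμA.ne (expVec g))).comp
      (ContinuousLinearMap.snd ℂ (Fock μ) (FockField μ)))
    (L' := (innerSL ℂ v).comp (ContinuousLinearMap.fst ℂ (Fock μ) (FockField μ))) ?_ hp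
  · have key' : inner ℂ (indicatorConstLp 2 hA hμA.ne (expVec g)) p.2 = inner ℂ v p.1 := key
    rw [key', h0, inner_zero_right, map_zero]
  intro k
  change inner ℂ (indicatorConstLp 2 hA hμA.ne (expVec g)) (expField k) = inner ℂ v (expVec k)
  have hint : ∫ t in A, expField k t ∂μ = (inner ℂ h k : ℂ) • expVec k := by
    rw [L2.inner_indicatorConstLp_one, ← integral_smul_const]
    exact integral_congr_ae (ae_restrict_of_ae (coeFn_expField k))
  rw [L2.inner_indicatorConstLp_eq_inner_setIntegral, hint, inner_smul_right, inner_expVec,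
    ← inner_conj_symm v, hv, map_mul, inner_conj_symm, ← Complex.exp_conj, inner_conj_symm]

theorem gradient_mem_graph (φ : (gradient μ).domain) :
    ((φ : Fock μ), gradient μ φ) ∈ gradientGraph μ :=
  Submodule.mem_graph_toLinearPMap gradientGraph_snd_eq_zero φ

theorem expVec_mem_gradient_domain (k : OneParticle μ) : expVec k ∈ (gradient μ).domain :=
  ⟨_, expVec_expField_mem k, rfl⟩

theorem dense_gradient_domain : Dense ((gradient μ).domain : Set (Fock μ)) :=
  (dense_span_expVec μ).mono <| Submodule.span_le.2 <| by
    rintro _ ⟨k, rfl⟩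
    exact expVec_mem_gradient_domain k

/-! ### Square integrable processes acting on vectors and on fields -/

/-- A strongly measurable process acts measurably on measurable fields of vectors. -/
theorem aestronglyMeasurable_process_apply {F : T → BoundedOp μ}
    (hF : ∀ ψ : Fock μ, AEStronglyMeasurable (fun t => F t ψ) μ) {f : T → Fock μ}
    (hf : AEStronglyMeasurable f μ) : AEStronglyMeasurable (fun t => F t (f t)) μ := by
  obtain ⟨g, hg, hfg⟩ := hf
  refine AEStronglyMeasurable.congr ?_ (hfg.mono fun t ht => congrArg (F t) ht.symm)
  have hs : ∀ s : SimpleFunc T (Fock μ), AEStronglyMeasurable (fun t => F t (s t)) μ := by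
    intro s
    induction s using SimpleFunc.induction with
    | @const c A hA =>
      refine ((hF c).indicator hA).congr (Filter.Eventually.of_forall fun t => ?_)
      by_cases ht : t ∈ A <;> simp [ht]
    | add _ hs1 hs2 => simpa using hs1.fun_add hs2
  exact aestronglyMeasurable_of_tendsto_ae Filter.atTop (fun n => hs (hg.approx n))
    (Filter.Eventually.of_forall fun t =>
      ((F t).continuous.tendsto _).comp (hg.tendsto_approx t))

theorem memLp_process_apply {F : T → BoundedOp μ}
    (hF : ∀ ψ : Fock μ, AEStronglyMeasurable (fun t => F t ψ) μ) {b : T → ℝ} (hb : MemLp b 2 μ)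
    (hFb : ∀ t, ‖F t‖ ≤ b t) (ψ : Fock μ) : MemLp (fun t => F t ψ) 2 μ :=
  hb.of_le_mul (c := ‖ψ‖) (hF ψ) (Filter.Eventually.of_forall fun t => by
    rw [mul_comm]
    exact ((F t).le_of_opNorm_le (hFb t) ψ).trans
      (mul_le_mul_of_nonneg_right (le_abs_self _) (norm_nonneg _)))

theorem integrable_process_apply {F : T → BoundedOp μ}
    (hF : ∀ ψ : Fock μ, AEStronglyMeasurable (fun t => F t ψ) μ) {b : T → ℝ} (hb : MemLp b 2 μ)
    (hFb : ∀ t, ‖F t‖ ≤ b t) (η : FockField μ) : Integrable (fun t => F t (η t)) μ :=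
  (hb.integrable_mul (Lp.memLp η).norm).mono'
    (aestronglyMeasurable_process_apply hF (Lp.aestronglyMeasurable η))
    (Filter.Eventually.of_forall fun t => (F t).le_of_opNorm_le (hFb t) _)

/-- The operator `ψ ↦ F_· ψ` from `Γ` to `L²(T, μ; Γ)` is bounded. -/
theorem exists_processApply {F : T → BoundedOp μ}
    (hF : ∀ ψ : Fock μ, AEStronglyMeasurable (fun t => F t ψ) μ) {b : T → ℝ} (hb : MemLp b 2 μ)
    (hFb : ∀ t, ‖F t‖ ≤ b t) :
    ∃ J : Fock μ →L[ℂ] FockField μ, ∀ ψ, J ψ = (memLp_process_apply hF hb hFb ψ).toLp _ := by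
  refine ⟨LinearMap.mkContinuous
    { toFun := fun ψ => (memLp_process_apply hF hb hFb ψ).toLp _
      map_add' := fun ψ φ => toLp_process_add F _ _ _
      map_smul' := fun c ψ => toLp_process_smul F c _ _ } ‖hb.toLp b‖ fun ψ => ?_, fun ψ => rfl⟩
  change ‖(memLp_process_apply hF hb hFb ψ).toLp _‖ ≤ _
  rw [mul_comm]
  refine Lp.norm_le_mul_norm_of_ae_le_mul ?_
  filter_upwards [(memLp_process_apply hF hb hFb ψ).coeFn_toLp, hb.coeFn_toLp] with t h1 h2
  rw [h1, h2, mul_comm]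
  exact ((F t).le_of_opNorm_le (hFb t) ψ).trans
    (mul_le_mul_of_nonneg_right (le_abs_self _) (norm_nonneg _))

/-- The operator `η ↦ ∫ F_t η_t dμ(t)` from `L²(T, μ; Γ)` to `Γ` is bounded. -/
theorem exists_processIntegral {F : T → BoundedOp μ}
    (hF : ∀ ψ : Fock μ, AEStronglyMeasurable (fun t => F t ψ) μ) {b : T → ℝ} (hb : MemLp b 2 μ)
    (hFb : ∀ t, ‖F t‖ ≤ b t) :
    ∃ I : FockField μ →L[ℂ] Fock μ, ∀ η, I η = ∫ t, F t (η t) ∂μ := by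
  have hi := integrable_process_apply hF hb hFb
  refine ⟨LinearMap.mkContinuous
    { toFun := fun η => ∫ t, F t (η t) ∂μ
      map_add' := fun η ζ => ?_
      map_smul' := fun c η => ?_ } ‖hb.toLp b‖ fun η => ?_, fun η => rfl⟩
  · rw [← integral_add (hi η) (hi ζ)]
    refine integral_congr_ae ?_
    filter_upwards [Lp.coeFn_add η ζ] with t ht
    rw [ht, Pi.add_apply, map_add]
  · rw [RingHom.id_apply, ← integral_smul]
    refine integral_congr_ae ?_
    filter_upwards [Lp.coeFn_smul c η] with t ht
    rw [ht, Pi.smul_apply, map_smul]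
  · have hη : MemLp (fun t => ‖η t‖) 2 μ := (Lp.memLp η).norm
    have hnorm : ‖hη.toLp _‖ = ‖η‖ := by
      rw [Lp.norm_toLp, eLpNorm_norm, Lp.norm_def]
    calc ‖∫ t, F t (η t) ∂μ‖ ≤ ∫ t, b t * ‖η t‖ ∂μ :=
          norm_integral_le_of_norm_le (hb.integrable_mul hη)
            (Filter.Eventually.of_forall fun t => (F t).le_of_opNorm_le (hFb t) _)
      _ = inner ℝ (hb.toLp b) (hη.toLp _) := by
          rw [L2.inner_def]
          refine integral_congr_ae ?_
          filter_upwards [hb.coeFn_toLp, hη.coeFn_toLp] with t h1 h2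
          rw [h1, h2, real_inner_comm]
          rfl
      _ ≤ ‖hb.toLp b‖ * ‖hη.toLp _‖ := real_inner_le_norm _ _
      _ = ‖hb.toLp b‖ * ‖η‖ := by rw [hnorm]

/-! ### The divergence as a sum of a creation and an annihilation integral -/

/-- On exponential vectors the defining relation of `M = δ(X)` reads
`⟨ℰ(k₁), M ℰ(k₂)⟩ = ⟨D̃ℰ(k₁), F_· ℰ(k₂)⟩ + ⟨ℰ(k₁), ∫ G_t (D̃ℰ(k₂))_t dμ(t)⟩` with
`F = X² - iX¹` and `G = X² + iX¹`. Every term is continuous for the graph norm of `D̃`, so that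
the identity extends to the whole domain of `D̃` in both arguments. -/
theorem IsDivergence.inner_eq {X : (T → BoundedOp μ) × (T → BoundedOp μ)} {M : BoundedOp μ}
    (hM : IsDivergence X M) {J : Fock μ →L[ℂ] FockField μ} {I : FockField μ →L[ℂ] Fock μ}
    (hJm : ∀ ψ, MemLp (fun t => (X.2 t - Complex.I • X.1 t) ψ) 2 μ)
    (hJ : ∀ ψ, J ψ = (hJm ψ).toLp _)
    (hIi : ∀ η : FockField μ, Integrable (fun t => (X.2 t + Complex.I • X.1 t) (η t)) μ)
    (hI : ∀ η : FockField μ, I η = ∫ t, (X.2 t + Complex.I • X.1 t) (η t) ∂μ)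
    {p q : Fock μ × FockField μ} (hp : p ∈ gradientGraph μ) (hq : q ∈ gradientGraph μ) :
    inner ℂ p.1 (M q.1) = inner ℂ p.2 (J q.1) + inner ℂ p.1 (I q.2) := by
  have hexp : ∀ k₁ k₂ : OneParticle μ, inner ℂ (expVec k₁) (M (expVec k₂)) =
      inner ℂ (expField k₁) (J (expVec k₂)) + inner ℂ (expVec k₁) (I (expField k₂)) := by
    intro k₁ k₂
    rw [hM k₁ k₂, hI, ← integral_inner (hIi _), L2.inner_def,
      ← integral_add (L2.integrable_inner _ _) ((hIi _).const_inner _)]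
    refine integral_congr_ae ?_
    filter_upwards [coeFn_expField k₁, coeFn_expField k₂, (hJm (expVec k₂)).coeFn_toLp]
      with t h1 h2 h3
    rw [hJ, h1, h2, h3]
    simp only [sub_apply, add_apply,
      smul_apply, map_smul, inner_add_right, inner_sub_right,
      inner_smul_left, inner_smul_right]
    ring
  have hleft : ∀ k₁ : OneParticle μ, inner ℂ (expVec k₁) (M q.1) =
      inner ℂ (expField k₁) (J q.1) + inner ℂ (expVec k₁) (I q.2) := fun k₁ =>
    eq_of_mem_gradientGraph
      (L := (innerSL ℂ (expVec k₁)).comp (M.comp (.fst ℂ (Fock μ) (FockField μ))))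
      (L' := (innerSL ℂ (expField k₁)).comp (J.comp (.fst ℂ (Fock μ) (FockField μ))) +
        (innerSL ℂ (expVec k₁)).comp (I.comp (.snd ℂ (Fock μ) (FockField μ))))
      (hexp k₁) hq
  have h : inner ℂ (M q.1) p.1 = inner ℂ (J q.1) p.2 + inner ℂ (I q.2) p.1 :=
    eq_of_mem_gradientGraph
      (L := (innerSL ℂ (M q.1)).comp (.fst ℂ (Fock μ) (FockField μ)))
      (L' := (innerSL ℂ (J q.1)).comp (.snd ℂ (Fock μ) (FockField μ)) +
        (innerSL ℂ (I q.2)).comp (.fst ℂ (Fock μ) (FockField μ)))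
      (fun k => by
        have hk := congrArg conj (hleft k)
        simp only [map_add, inner_conj_symm] at hk
        exact hk) hp
  simpa only [map_add, inner_conj_symm] using congrArg conj h

/-- If `X` is Hitsuda–Skorohod integrable with `δ(X) = M`, then every `ψ ∈ Dom D̃` belongs to the
domains of both Belavkin–Lindsay integrals, and their sum maps it to `M ψ`. -/
theorem IsDivergence.creationIntegral_add_annihilationIntegral
    {X : (T → BoundedOp μ) × (T → BoundedOp μ)} (h1 : IsL2Process X.1) (h2 : IsL2Process X.2)
    {M : BoundedOp μ} (hM : IsDivergence X M) {ψ : Fock μ} (hψ : ψ ∈ (gradient μ).domain) :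
    ∃ h : ψ ∈ (creationIntegral (fun t => X.2 t - Complex.I • X.1 t) +
        annihilationIntegral (fun t => X.2 t + Complex.I • X.1 t)).domain,
      M ψ = (creationIntegral (fun t => X.2 t - Complex.I • X.1 t) +
        annihilationIntegral (fun t => X.2 t + Complex.I • X.1 t)) ⟨ψ, h⟩ := by
  -- `‖X² ∓ iX¹‖` need not be measurable, so it is controlled by `‖X²‖ + ‖X¹‖`.
  have hb : MemLp (fun t => ‖X.2 t‖ + ‖X.1 t‖) 2 μ := h2.2.add h1.2
  have hF : ∀ φ : Fock μ, AEStronglyMeasurable (fun t => (X.2 t - Complex.I • X.1 t) φ) μ :=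
    fun φ => (h2.1 φ).sub ((h1.1 φ).const_smul Complex.I)
  have hG : ∀ φ : Fock μ, AEStronglyMeasurable (fun t => (X.2 t + Complex.I • X.1 t) φ) μ :=
    fun φ => (h2.1 φ).add ((h1.1 φ).const_smul Complex.I)
  have hI1 : ∀ t, ‖Complex.I • X.1 t‖ ≤ ‖X.1 t‖ := fun t => by
    simpa using (X.1 t).opNorm_smul_le Complex.I
  have hFb : ∀ t, ‖X.2 t - Complex.I • X.1 t‖ ≤ ‖X.2 t‖ + ‖X.1 t‖ := fun t =>
    (norm_sub_le (X.2 t) (Complex.I • X.1 t)).trans (add_le_add_right (hI1 t) _)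
  have hGb : ∀ t, ‖X.2 t + Complex.I • X.1 t‖ ≤ ‖X.2 t‖ + ‖X.1 t‖ := fun t =>
    (norm_add_le (X.2 t) (Complex.I • X.1 t)).trans (add_le_add_right (hI1 t) _)
  obtain ⟨J, hJ⟩ := exists_processApply hF hb hFb
  obtain ⟨I, hI⟩ := exists_processIntegral hG hb hGb
  have hadj : ∀ φ : (gradient μ).domain,
      inner ℂ (M ψ - I (gradient μ ⟨ψ, hψ⟩)) (φ : Fock μ) = inner ℂ (J ψ) (gradient μ φ) := by
    intro φ
    have h := hM.inner_eq _ hJ (integrable_process_apply hG hb hGb) hI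
      (gradient_mem_graph φ) (gradient_mem_graph ⟨ψ, hψ⟩)
    have h' := congrArg conj h
    simp only [map_add, inner_conj_symm] at h'
    rw [inner_sub_left, h', add_sub_cancel_right]
  have hmem : (memLp_process_apply hF hb hFb ψ).toLp _ ∈ (skorohod μ).domain := by
    rw [← hJ]
    exact LinearPMap.mem_adjoint_domain_of_exists _ ⟨_, hadj⟩
  have hcre : skorohod μ ⟨_, hmem⟩ = M ψ - I (gradient μ ⟨ψ, hψ⟩) :=
    LinearPMap.adjoint_apply_eq dense_gradient_domain _ fun φ => (hadj φ).trans (by rw [hJ])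
  refine ⟨⟨⟨memLp_process_apply hF hb hFb ψ, hmem⟩,
    ⟨hψ, integrable_process_apply hG hb hGb _⟩⟩, ?_⟩
  change M ψ = skorohod μ ⟨_, hmem⟩ + ∫ t, (X.2 t + Complex.I • X.1 t) (gradient μ ⟨ψ, hψ⟩ t) ∂μ
  rw [hcre, ← hI, sub_add_cancel]

end WhiteNoise

theorem mainTheorem3
    (X : (ℝ → BoundedOp halfLine) × (ℝ → BoundedOp halfLine))
    (hX : X ∈ divergenceDomain halfLine)
    (M : BoundedOp halfLine) (hM : IsDivergence X M) :
    (∀ k : OneParticle halfLine,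
      expVec k ∈ (creationIntegral (fun t => X.2 t - Complex.I • X.1 t) +
        annihilationIntegral (fun t => X.2 t + Complex.I • X.1 t)).domain) ∧
    Dense ((creationIntegral (fun t => X.2 t - Complex.I • X.1 t) +
        annihilationIntegral (fun t => X.2 t + Complex.I • X.1 t)).domain :
          Set (Fock halfLine)) ∧
    ∀ ψ : (creationIntegral (fun t => X.2 t - Complex.I • X.1 t) +
        annihilationIntegral (fun t => X.2 t + Complex.I • X.1 t)).domain,
      M ψ = (creationIntegral (fun t => X.2 t - Complex.I • X.1 t) +
        annihilationIntegral (fun t => X.2 t + Complex.I • X.1 t)) ψ := by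
  obtain ⟨h1, h2, -⟩ := hX
  have key := fun {ψ : Fock halfLine} (hψ : ψ ∈ (gradient halfLine).domain) =>
    hM.creationIntegral_add_annihilationIntegral h1 h2 hψ
  have hexp := fun k : OneParticle halfLine => (key (expVec_mem_gradient_domain k)).1
  refine ⟨hexp, (dense_span_expVec halfLine).mono (Submodule.span_le.2 ?_), fun ψ => ?_⟩
  · rintro _ ⟨k, rfl⟩
    exact hexp k
  · exact (key ψ.2.2.1).2
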